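/- Let $k$ be an algebraically closed field and let $A$ be a finite-dimensional unital associative $k$-algebra. Modules are finitely generated left $A$-modules, and a module $X$ is called a brick if $\operatorname{End}_A(X)\cong k$ as $k$-algebras. The following are equivalent: 1. $A$ admits an infinite family of pairwise non-isomorphic bricks, all of the same $k$-dimension. 2. There are an integer $d\ge 1$ and an infinite family $\{X_i\}_{i\in I}$ of $A$-modules of $k$-dimension $d$ such that, for all distinct $i,j\in I$, we have $\operatorname{Hom}_A(X_i,X_j)=0$ or $\operatorname{Hom}_A(X_j,X_i)=0$. -/

import Mathlib

open scoped ModuleCat.Algebra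

universe u v

section Bricks

variable (k : Type u) [Field k] (A : Type v) [Ring A] [Algebra k A]

/-- A left `A`-module `X` is finitely generated and has dimension `d` over `k`, where `k` acts on
`X` through the structure map `k → A`. Modules are taken in the universe of `k`: every
finite-dimensional `A`-module is isomorphic to one with underlying space `Fin d → k`. -/
def HasDim (X : ModuleCat.{u} A) (d : ℕ) : Prop :=
  Module.Finite A X ∧ Module.Finite k X ∧ Module.finrank k X = d

/-- A brick: a finite-dimensional left `A`-module whose endomorphism algebra is isomorphic to the
ground field, as an algebra over it. -/
def IsBrick (X : ModuleCat.{u} A) : Prop :=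
  Module.Finite k X ∧ Nonempty (Module.End A X ≃ₐ[k] k)

/-- There is an infinite family of pairwise non-isomorphic bricks, all of the same dimension. -/
def HasInfiniteBrickFamily : Prop :=
  ∃ (d : ℕ) (I : Type u) (X : I → ModuleCat.{u} A), Infinite I ∧
    (∀ i, IsBrick k A (X i) ∧ HasDim k A (X i) d) ∧
    ∀ i j, i ≠ j → IsEmpty (X i ≃ₗ[A] X j)

/-- There is an infinite family of modules, all of one positive dimension `d`, such that for
distinct indices there is no non-zero homomorphism in at least one of the two directions.
(As `d` is positive, the members are then pairwise non-isomorphic; `d = 0` has to be excluded since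
the only module of dimension zero, up to isomorphism, is the zero module.) -/
def HasInfiniteOneSidedOrthogonalFamily : Prop :=
  ∃ (d : ℕ) (I : Type u) (X : I → ModuleCat.{u} A), 0 < d ∧ Infinite I ∧
    (∀ i, HasDim k A (X i) d) ∧
    ∀ i j, i ≠ j → (∀ f : X i →ₗ[A] X j, f = 0) ∨ (∀ f : X j →ₗ[A] X i, f = 0)

end Bricks

section BrickLemmas

variable {k : Type u} [Field k] {A : Type v} [Ring A] [Algebra k A]

/-! Every non-zero finite-dimensional module has a brick that is both a quotient and a submodule of
it (`exists_brick_quotient_submodule`). From orthogonality to bricks: if the bricks of `X i` and `X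
j` were isomorphic, non-zero maps would exist in both directions. Their dimensions are bounded, so
pigeonhole finishes. Conversely, take the least `d` with infinitely many bricks. Only finitely many
smaller bricks exist, so infinitely many `X i` share the same small brick quotients and submodules.
A non-zero map between two of these would factor through a small brick, giving a non-invertible
non-zero endomorphism. -/

theorem HasDim.of_finite {X : ModuleCat.{u} A} (hX : Module.Finite k X) {d : ℕ}
    (hd : Module.finrank k X = d) : HasDim k A X d :=
  ⟨Module.Finite.of_restrictScalars_finite k A X, hX, hd⟩

theorem finite_of_surjective_linearMap {X Y : ModuleCat.{u} A} [Module.Finite k X]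
    (f : X →ₗ[A] Y) (hf : Function.Surjective f) : Module.Finite k Y :=
  Module.Finite.of_surjective (f.restrictScalars k) hf

theorem finrank_le_of_surjective_linearMap {X Y : ModuleCat.{u} A} [Module.Finite k X]
    (f : X →ₗ[A] Y) (hf : Function.Surjective f) : Module.finrank k Y ≤ Module.finrank k X :=
  LinearMap.finrank_le_finrank_of_surjective (f := f.restrictScalars k) hf

theorem bijective_of_injective_of_finrank_le {X Y : ModuleCat.{u} A} [Module.Finite k X]
    [Module.Finite k Y] (f : X →ₗ[A] Y) (hf : Function.Injective f)
    (h : Module.finrank k Y ≤ Module.finrank k X) : Function.Bijective f :=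
  ⟨hf, (LinearMap.injective_iff_surjective_of_finrank_eq_finrank (f := f.restrictScalars k)
    (le_antisymm (LinearMap.finrank_le_finrank_of_injective (f := f.restrictScalars k) hf) h)).1 hf⟩

theorem bijective_of_surjective_of_finrank_le {X Y : ModuleCat.{u} A} [Module.Finite k X]
    [Module.Finite k Y] (f : X →ₗ[A] Y) (hf : Function.Surjective f)
    (h : Module.finrank k X ≤ Module.finrank k Y) : Function.Bijective f :=
  ⟨(LinearMap.injective_iff_surjective_of_finrank_eq_finrank (f := f.restrictScalars k)
    (le_antisymm h (finrank_le_of_surjective_linearMap f hf))).2 hf, hf⟩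

theorem IsBrick.nontrivial {X : ModuleCat.{u} A} (hX : IsBrick k A X) : Nontrivial X := by
  obtain ⟨-, ⟨e⟩⟩ := hX
  by_contra h
  rw [not_nontrivial_iff_subsingleton] at h
  have : Subsingleton (Module.End A X) := ⟨fun f g => LinearMap.ext fun x => Subsingleton.elim _ _⟩
  exact zero_ne_one (e.symm.injective (Subsingleton.elim (e.symm 0) (e.symm 1)))

/-- A non-zero endomorphism of a brick is bijective. -/
theorem IsBrick.bijective {X : ModuleCat.{u} A} (hX : IsBrick k A X) {f : Module.End A X}
    (hf : f ≠ 0) : Function.Bijective f := by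
  obtain ⟨-, ⟨e⟩⟩ := hX
  have h : IsUnit (e f) := isUnit_iff_ne_zero.2 ((map_ne_zero_iff e e.injective).2 hf)
  exact (Module.End.isUnit_iff f).1 ((MulEquiv.isUnit_map e).1 h)

/-- Over an algebraically closed field, a finite-dimensional module all of whose non-zero
endomorphisms are injective is a brick. -/
theorem IsBrick.of_injective [IsAlgClosed k] {X : ModuleCat.{u} A} [Module.Finite k X]
    [Nontrivial X] (h : ∀ f : Module.End A X, f ≠ 0 → Function.Injective f) : IsBrick k A X := by
  refine ⟨inferInstance, ?_⟩
  have : Module.Finite k (Module.End A X) :=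
    Module.Finite.of_injective
      ({ toFun := fun f => f.restrictScalars k
         map_add' := fun _ _ => rfl
         map_smul' := fun _ _ => rfl } : Module.End A X →ₗ[k] Module.End k X)
      (LinearMap.restrictScalars_injective k)
  have : NoZeroDivisors (Module.End A X) := ⟨fun {f g} hfg => by
    by_contra! hne
    refine hne.2 (LinearMap.ext fun x => h f hne.1 ?_)
    simpa using LinearMap.congr_fun hfg x⟩
  have : IsDomain (Module.End A X) := NoZeroDivisors.to_isDomain _
  exact ⟨(AlgEquiv.ofBijective (Algebra.ofId k (Module.End A X))
    (IsAlgClosed.algebraMap_bijective_of_isIntegral (k := k))).symm⟩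

/-- Every non-zero finite-dimensional module has a quotient that is a brick and embeds back into
the module. -/
theorem exists_brick_quotient_submodule [IsAlgClosed k] (X : ModuleCat.{u} A)
    [hX : Module.Finite k X] [Nontrivial X] :
    ∃ B : ModuleCat.{u} A, IsBrick k A B ∧ (∃ p : X →ₗ[A] B, Function.Surjective p) ∧
      ∃ i : B →ₗ[A] X, Function.Injective i := by
  induction hn : Module.finrank k X using Nat.strong_induction_on generalizing X with
  | _ n ih =>
    -- Otherwise pass to the image of a non-injective endomorphism: it is a smaller module, both a
    -- quotient and a submodule of `X`.
    by_cases h : ∀ f : Module.End A X, f ≠ 0 → Function.Injective f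
    · exact ⟨X, .of_injective h, ⟨.id, Function.surjective_id⟩, ⟨.id, Function.injective_id⟩⟩
    push Not at h
    obtain ⟨f, hf0, hf⟩ := h
    let Y : ModuleCat.{u} A := ModuleCat.of A (LinearMap.range f)
    let q : X →ₗ[A] Y := f.rangeRestrict
    have hq : Function.Surjective q := f.surjective_rangeRestrict
    have : Module.Finite k Y := finite_of_surjective_linearMap q hq
    have : Nontrivial Y := Submodule.nontrivial_iff_ne_bot.2 (mt LinearMap.range_eq_bot.1 hf0)
    have hlt : Module.finrank k Y < n := by
      by_contra! hle
      refine hf ?_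
      have := (bijective_of_surjective_of_finrank_le q hq (hn.trans_le hle)).1
      exact Subtype.val_injective.comp this
    obtain ⟨B, hB, ⟨p, hp⟩, ⟨i, hi⟩⟩ := ih _ hlt Y rfl
    let j : Y →ₗ[A] X := (LinearMap.range f).subtype
    exact ⟨B, hB, ⟨p ∘ₗ q, hp.comp hq⟩, ⟨j ∘ₗ i, Subtype.val_injective.comp hi⟩⟩

/-- A non-zero homomorphism yields a brick that is a quotient of its image and embeds into it. -/
theorem exists_brick_of_ne_zero [IsAlgClosed k] {X Y : ModuleCat.{u} A} [Module.Finite k X]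
    {f : X →ₗ[A] Y} (hf : f ≠ 0) :
    ∃ B : ModuleCat.{u} A, IsBrick k A B ∧ (∃ p : X →ₗ[A] B, Function.Surjective p) ∧
      ∃ i : B →ₗ[A] Y, Function.Injective i := by
  let Z : ModuleCat.{u} A := ModuleCat.of A (LinearMap.range f)
  let q : X →ₗ[A] Z := f.rangeRestrict
  have hq : Function.Surjective q := f.surjective_rangeRestrict
  have : Module.Finite k Z := finite_of_surjective_linearMap q hq
  have : Nontrivial Z := Submodule.nontrivial_iff_ne_bot.2 (mt LinearMap.range_eq_bot.1 hf)
  obtain ⟨B, hB, ⟨p, hp⟩, ⟨i, hi⟩⟩ := exists_brick_quotient_submodule (k := k) Z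
  let j : Z →ₗ[A] Y := (LinearMap.range f).subtype
  exact ⟨B, hB, ⟨p ∘ₗ q, hp.comp hq⟩, ⟨j ∘ₗ i, Subtype.val_injective.comp hi⟩⟩

theorem comp_ne_zero_of_surjective_of_injective {X B Y : ModuleCat.{u} A} [Nontrivial B]
    {p : X →ₗ[A] B} (hp : Function.Surjective p) {i : B →ₗ[A] Y} (hi : Function.Injective i) :
    i ∘ₗ p ≠ 0 := by
  intro h
  obtain ⟨b, hb⟩ := exists_ne (0 : B)
  obtain ⟨x, rfl⟩ := hp b
  exact hb (hi (by simpa using LinearMap.congr_fun h x))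

variable (k A) in
/-- There is an infinite family of pairwise non-isomorphic bricks of dimension `d`. -/
def HasInfiniteBrickFamilyOfDim (d : ℕ) : Prop :=
  ∃ (I : Type u) (X : I → ModuleCat.{u} A), Infinite I ∧
    (∀ i, IsBrick k A (X i) ∧ HasDim k A (X i) d) ∧
    ∀ i j, i ≠ j → IsEmpty (X i ≃ₗ[A] X j)

/-- An infinite family of pairwise non-isomorphic bricks of bounded dimension contains one of
constant dimension. -/
theorem exists_hasInfiniteBrickFamilyOfDim {I : Type u} [Infinite I] (X : I → ModuleCat.{u} A)
    (hX : ∀ i, IsBrick k A (X i)) (hiso : ∀ i j, i ≠ j → IsEmpty (X i ≃ₗ[A] X j)) {d : ℕ}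
    (hd : ∀ i, Module.finrank k (X i) < d) : ∃ n < d, HasInfiniteBrickFamilyOfDim k A n := by
  obtain ⟨n, hn⟩ := Finite.exists_infinite_fiber
    fun i => (⟨Module.finrank k (X i), hd i⟩ : Fin d)
  refine ⟨n, n.2, _, fun i => X i.1, hn, fun i => ⟨hX _, .of_finite (hX _).1 ?_⟩, fun i j hij =>
    hiso _ _ fun h => hij (Subtype.ext h)⟩
  exact congrArg Fin.val i.2

variable (k A) in
/-- The bricks of dimension less than `d`. -/
abbrev BrickBelow (d : ℕ) : Type _ :=
  {B : ModuleCat.{u} A // IsBrick k A B ∧ Module.finrank k B < d}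

variable (k A) in
/-- Isomorphism of bricks of dimension less than `d`. -/
def brickBelowSetoid (d : ℕ) : Setoid (BrickBelow k A d) where
  r B C := Nonempty (B.1 ≃ₗ[A] C.1)
  iseqv := ⟨fun _ => ⟨.refl _ _⟩, fun ⟨e⟩ => ⟨e.symm⟩, fun ⟨e⟩ ⟨f⟩ => ⟨e.trans f⟩⟩

/-- If no dimension less than `d` has infinitely many bricks, then there are only finitely many
isomorphism classes of bricks of dimension less than `d`. -/
theorem finite_brickBelow_quotient {d : ℕ} (h : ∀ n < d, ¬ HasInfiniteBrickFamilyOfDim k A n) :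
    Finite (Quotient (brickBelowSetoid k A d)) := by
  by_contra hinf
  rw [not_finite_iff_infinite] at hinf
  let e := Infinite.natEmbedding (Quotient (brickBelowSetoid k A d))
  let B : ULift.{u} ℕ → BrickBelow k A d := fun i => (e i.down).out
  have hB (i j : ULift.{u} ℕ) (hij : i ≠ j) : IsEmpty ((B i).1 ≃ₗ[A] (B j).1) :=
    ⟨fun f => hij (ULift.ext _ _ (e.injective (Quotient.out_equiv_out.1 ⟨f⟩)))⟩
  obtain ⟨n, hn, hfam⟩ := exists_hasInfiniteBrickFamilyOfDim (fun i => (B i).1)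
    (fun i => (B i).2.1) hB (fun i => (B i).2.2)
  exact h n hn hfam

theorem hasInfiniteOneSidedOrthogonalFamily_of_minimal [IsAlgClosed k] {d : ℕ}
    (hd : HasInfiniteBrickFamilyOfDim k A d)
    (hmin : ∀ n < d, ¬ HasInfiniteBrickFamilyOfDim k A n) :
    HasInfiniteOneSidedOrthogonalFamily k A := by
  obtain ⟨I, X, hI, hX, hiso⟩ := hd
  have (i : I) : Module.Finite k (X i) := (hX i).1.1
  have hdim (i : I) : Module.finrank k (X i) = d := (hX i).2.2.2
  let Q := Quotient (brickBelowSetoid k A d)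
  have : Finite Q := finite_brickBelow_quotient hmin
  let S (i : I) : Set Q :=
    {c | ∃ B, Quotient.mk _ B = c ∧ ∃ p : X i →ₗ[A] B.1, Function.Surjective p}
  let T (i : I) : Set Q :=
    {c | ∃ B, Quotient.mk _ B = c ∧ ∃ p : B.1 →ₗ[A] X i, Function.Injective p}
  -- A small brick that is both a quotient and a submodule of `X i` yields a non-zero endomorphism,
  -- hence an automorphism, whose image has dimension below `d`.
  have hST (i : I) (c : Q) (hS : c ∈ S i) (hT : c ∈ T i) : False := by
    obtain ⟨B, hB, p, hp⟩ := hS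
    obtain ⟨C, hC, j, hj⟩ := hT
    obtain ⟨e⟩ : Nonempty (B.1 ≃ₗ[A] C.1) := Quotient.exact (hB.trans hC.symm)
    have := C.2.1.nontrivial
    have hep : Function.Surjective (e.toLinearMap ∘ₗ p) := e.surjective.comp hp
    have hbij := (hX i).1.bijective (comp_ne_zero_of_surjective_of_injective hep hj)
    have hjsurj : Function.Surjective j := Function.Surjective.of_comp hbij.2
    have := C.2.1.1
    have hle := finrank_le_of_surjective_linearMap (k := k) j hjsurj
    have := C.2.2
    have := hdim i
    omega
  obtain ⟨c, hc⟩ := Finite.exists_infinite_fiber fun i => (S i, T i)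
  obtain ⟨i₀⟩ : Nonempty I := inferInstance
  refine ⟨d, _, fun i => X i.1, ?_, hc, fun i => (hX i).2, fun i j hij => .inl fun f => ?_⟩
  · have := (hX i₀).1.nontrivial
    exact hdim i₀ ▸ Module.finrank_pos
  by_contra hf
  obtain ⟨B, hB, ⟨p, hp⟩, ⟨q, hq⟩⟩ := exists_brick_of_ne_zero (k := k) hf
  have := hB.1
  -- Otherwise `p` and `q` are isomorphisms and `X i ≅ B ≅ X j`.
  have hlt : Module.finrank k B < d := by
    by_contra! hle
    have h₁ := bijective_of_surjective_of_finrank_le p hp ((hdim i).trans_le hle)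
    have h₂ := bijective_of_injective_of_finrank_le q hq ((hdim j).trans_le hle)
    exact (hiso i j fun h => hij (Subtype.ext h)).false
      ((LinearEquiv.ofBijective p h₁).trans (LinearEquiv.ofBijective q h₂))
  have hST' : (S i, T i) = (S j, T j) := i.2.trans j.2.symm
  refine hST i (Quotient.mk _ ⟨B, hB, hlt⟩) ⟨_, rfl, p, hp⟩ ?_
  have hT : T i = T j := (Prod.ext_iff.1 hST').2
  rw [hT]
  exact ⟨_, rfl, q, hq⟩

theorem HasInfiniteBrickFamily.hasInfiniteOneSidedOrthogonalFamily [IsAlgClosed k]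
    (h : HasInfiniteBrickFamily k A) : HasInfiniteOneSidedOrthogonalFamily k A := by
  classical
  have h' : ∃ d, HasInfiniteBrickFamilyOfDim k A d := h
  exact hasInfiniteOneSidedOrthogonalFamily_of_minimal (Nat.find_spec h')
    fun _ => Nat.find_min h'

theorem HasInfiniteOneSidedOrthogonalFamily.hasInfiniteBrickFamily [IsAlgClosed k]
    (h : HasInfiniteOneSidedOrthogonalFamily k A) : HasInfiniteBrickFamily k A := by
  obtain ⟨d, I, X, hd, hI, hX, horth⟩ := h
  have (i : I) : Module.Finite k (X i) := (hX i).2.1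
  have (i : I) : Nontrivial (X i) :=
    Module.nontrivial_of_finrank_pos (R := k) ((hX i).2.2.symm ▸ hd)
  choose B hB hp hq using fun i => exists_brick_quotient_submodule (k := k) (X i)
  choose p hp using hp
  choose q hq using hq
  have hne (i j : I) (e : B i ≃ₗ[A] B j) : ∃ f : X i →ₗ[A] X j, f ≠ 0 := by
    have := (hB j).nontrivial
    have hep : Function.Surjective (e.toLinearMap ∘ₗ p i) := e.surjective.comp (hp i)
    exact ⟨_, comp_ne_zero_of_surjective_of_injective hep (hq j)⟩
  have hB' (i j : I) (hij : i ≠ j) : IsEmpty (B i ≃ₗ[A] B j) := by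
    refine ⟨fun e => ?_⟩
    obtain ⟨f, hf⟩ := hne i j e
    obtain ⟨g, hg⟩ := hne j i e.symm
    exact (horth i j hij).elim (fun h => hf (h f)) fun h => hg (h g)
  -- The bound is strict, hence `d + 1`.
  obtain ⟨n, -, hn⟩ := exists_hasInfiniteBrickFamilyOfDim B hB hB' (d := d + 1) fun i =>
    Nat.lt_succ_of_le ((finrank_le_of_surjective_linearMap (p i) (hp i)).trans_eq (hX i).2.2)
  exact ⟨n, hn⟩

end BrickLemmas

theorem mainTheorem8 (k : Type u) [Field k] [IsAlgClosed k]
    (A : Type v) [Ring A] [Algebra k A] [Module.Finite k A] :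
    HasInfiniteBrickFamily k A ↔ HasInfiniteOneSidedOrthogonalFamily k A :=
  ⟨HasInfiniteBrickFamily.hasInfiniteOneSidedOrthogonalFamily,
    HasInfiniteOneSidedOrthogonalFamily.hasInfiniteBrickFamily⟩
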